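/- For a real symmetric $m\times m$ matrix $M$ let $E_\ell(M)=e_\ell(\lambda_1(M),\dots,\lambda_m(M))$ be the $\ell$-th elementary symmetric polynomial $e_\ell(v)=\sum_{I\subseteq\{1,\dots,m\},\,|I|=\ell}\prod_{j\in I}v_j$ of its eigenvalues, counted with multiplicity. Call a function log-convex on a convex set if it is positive there and its logarithm is convex there. Let $X\in\mathbb{R}^{n\times m}$ have full column rank and let $1\le \ell\le m$. Then the map $M\mapsto E_\ell\bigl((X^\top M X)^{-1}\bigr)^{1/\ell}$ is log-convex on the set of symmetric positive definite $n\times n$ real matrices. Moreover, for every $k\in\mathbb{N}$, the continuous relaxation of ESP-design, $$\min_{z\in\Gamma_k^c}\ \tfrac1\ell\log E_\ell\bigl((X^\top \mathrm{Diag}(z)X)^{-1}\bigr),\qquad \Gamma_k^c=\Bigl\{z\in[0,1]^n : X^\top \mathrm{Diag}(z)X \text{ is invertible},\ \sum_{i=1}^n z_i\le k\Bigr\},$$ is a convex optimization problem: the feasible set $\Gamma_k^c$ is convex, and the objective is a convex function on $\Gamma_k^c$, with $E_\ell\bigl((X^\top \mathrm{Diag}(z)X)^{-1}\bigr)>0$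 for every $z\in\Gamma_k^c$. -/

import Mathlib

open scoped Matrix

noncomputable section

namespace ESPDesign

/-- The elementary symmetric polynomial `e_ℓ(v) = ∑_{|I| = ℓ} ∏_{j ∈ I} v_j` of a real vector. -/
def esymmVec {m : ℕ} (ℓ : ℕ) (v : Fin m → ℝ) : ℝ :=
  ∑ I ∈ Finset.powersetCard ℓ (Finset.univ : Finset (Fin m)), ∏ j ∈ I, v j

open scoped Classical in
/-- `E_ℓ(M) = e_ℓ(λ(M))`, where `λ(M)` is the vector of eigenvalues (with multiplicity) of the
symmetric real matrix `M`. The value on non-symmetric matrices is a convention, set to `0`. -/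
def E {m : ℕ} (ℓ : ℕ) (M : Matrix (Fin m) (Fin m) ℝ) : ℝ :=
  if hM : M.IsHermitian then esymmVec ℓ hM.eigenvalues else 0

/-- A real function is log-convex on `s` if it is positive on `s` and its logarithm is a convex
function on the (convex) set `s`. -/
def LogConvexOn {V : Type*} [AddCommGroup V] [Module ℝ V] (s : Set V) (f : V → ℝ) : Prop :=
  (∀ x ∈ s, 0 < f x) ∧ ConvexOn ℝ s (fun x => Real.log (f x))

/-- The feasible set of the continuous relaxation: vectors `z ∈ [0,1]^n` such that
`Xᵀ Diag(z) X` is invertible and `∑ i, z i ≤ k`. -/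
def relaxedFeasible {n m : ℕ} (X : Matrix (Fin n) (Fin m) ℝ) (k : ℕ) : Set (Fin n → ℝ) :=
  {z | (∀ i, 0 ≤ z i ∧ z i ≤ 1) ∧ IsUnit (Xᵀ * Matrix.diagonal z * X) ∧ ∑ i, z i ≤ (k : ℝ)}

/-- The objective of the continuous relaxation: `(1/ℓ) log E_ℓ((Xᵀ Diag(z) X)⁻¹)`. -/
def relaxedObjective {n m : ℕ} (X : Matrix (Fin n) (Fin m) ℝ) (ℓ : ℕ) (z : Fin n → ℝ) : ℝ :=
  (1 / (ℓ : ℝ)) * Real.log (E ℓ (Xᵀ * Matrix.diagonal z * X)⁻¹)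

/-- The problem of minimizing `f` over `s` is a convex optimization problem: the feasible set `s`
is convex and the objective `f` is a convex function on it. -/
def IsConvexProblem {V : Type*} [AddCommGroup V] [Module ℝ V] (s : Set V) (f : V → ℝ) : Prop :=
  Convex ℝ s ∧ ConvexOn ℝ s f

end ESPDesign

end

/-!
The crux is that `A ↦ log (E ℓ A⁻¹)` is convex on positive definite matrices; the theorem follows
by composing with the linear maps `M ↦ Xᵀ * M * X` and `z ↦ Xᵀ * diagonal z * X`. Full column rank
makes the first preserve positive definiteness. For the second, `Xᵀ * diagonal z * X` is positive
semidefinite when `0 ≤ z`, so that invertibility is the same as positive definiteness.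

For the crux, a segment between positive definite matrices is put in diagonal form by one
congruence: `A = P * Pᵀ` and `B = P * diagonal d * Pᵀ` (`exists_simultaneous_congr`). As `E ℓ` is,
up to sign, a coefficient of the characteristic polynomial, it is the sum of the principal minors
of order `ℓ`, and that coefficient is the same for `R * S` and `S * R`. Hence
`E ℓ (P * diagonal d * Pᵀ)⁻¹ = ∑ I, c I * ∏ i ∈ I, (d i)⁻¹`, with `c I > 0` the principal minors
of `P⁻¹ * (P⁻¹)ᵀ` (`E_inv_congr_diagonal`). Each product is log-convex in `d` by the weighted
AM-GM inequality, and positive combinations of log-convex functions are log-convex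
(`log_sum_mul_le`, a form of Hölder's inequality).
-/

open Finset in
/-- The two-point form of Hölder's inequality for finite weighted sums, with logarithms taken:
a positive combination of functions that are log-convex along a segment is log-convex there. -/
theorem log_sum_mul_le {ι : Type*} (s : Finset ι) {c w x y : ι → ℝ} {a b : ℝ}
    (hs : s.Nonempty) (hc : ∀ i ∈ s, 0 < c i) (hw : ∀ i ∈ s, 0 < w i)
    (hx : ∀ i ∈ s, 0 < x i) (hy : ∀ i ∈ s, 0 < y i) (ha : 0 < a) (hb : 0 < b) (hab : a + b = 1)
    (h : ∀ i ∈ s, w i ≤ x i ^ a * y i ^ b) :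
    Real.log (∑ i ∈ s, c i * w i) ≤
      a * Real.log (∑ i ∈ s, c i * x i) + b * Real.log (∑ i ∈ s, c i * y i) := by
  set F := ∑ i ∈ s, c i * x i with hF
  set G := ∑ i ∈ s, c i * y i with hG
  have hF0 : 0 < F := sum_pos (fun i hi => mul_pos (hc i hi) (hx i hi)) hs
  have hG0 : 0 < G := sum_pos (fun i hi => mul_pos (hc i hi) (hy i hi)) hs
  have hW0 : 0 < ∑ i ∈ s, c i * w i := sum_pos (fun i hi => mul_pos (hc i hi) (hw i hi)) hs
  have key : ∑ i ∈ s, c i * w i ≤ F ^ a * G ^ b := by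
    -- AM-GM is applied to `x i / F` and `y i / G`, whose `c`-weighted sums are both `1`.
    have hterm : ∀ i ∈ s,
        c i * w i ≤ F ^ a * G ^ b * (a * (c i * x i / F) + b * (c i * y i / G)) := by
      intro i hi
      have hamgm := Real.geom_mean_le_arith_mean2_weighted ha.le hb.le
        (div_pos (hx i hi) hF0).le (div_pos (hy i hi) hG0).le hab
      rw [Real.div_rpow (hx i hi).le hF0.le, Real.div_rpow (hy i hi).le hG0.le, div_mul_div_comm,
        div_le_iff₀ (by positivity)] at hamgm
      calc c i * w i ≤ c i * ((a * (x i / F) + b * (y i / G)) * (F ^ a * G ^ b)) :=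
            mul_le_mul_of_nonneg_left ((h i hi).trans hamgm) (hc i hi).le
        _ = _ := by ring
    refine (sum_le_sum hterm).trans_eq ?_
    rw [← mul_sum, sum_add_distrib, ← mul_sum, ← mul_sum, ← sum_div, ← sum_div, ← hF, ← hG,
      div_self hF0.ne', div_self hG0.ne', mul_one, mul_one, hab, mul_one]
  refine (Real.log_le_log hW0 key).trans_eq ?_
  rw [Real.log_mul (by positivity) (by positivity), Real.log_rpow hF0, Real.log_rpow hG0]

namespace ESPDesign

open Matrix

/-- `E ℓ` of a symmetric matrix is the signed coefficient of its characteristic polynomial. -/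
theorem E_eq_charpoly_coeff {m ℓ : ℕ} (hℓ : ℓ ≤ m) {M : Matrix (Fin m) (Fin m) ℝ}
    (hM : M.IsHermitian) : E ℓ M = (-1) ^ ℓ * M.charpoly.coeff (m - ℓ) := by
  rw [E, dif_pos hM, hM.charpoly_eq]
  have h := Finset.prod_X_add_C_coeff (Finset.univ : Finset (Fin m))
    (fun i => -hM.eigenvalues i) (k := m - ℓ) (by simp)
  have h2 : ∏ i, (Polynomial.X - Polynomial.C (RCLike.ofReal (hM.eigenvalues i) : ℝ)) =
      ∏ i, (Polynomial.X + Polynomial.C (-hM.eigenvalues i)) := by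
    simp [sub_eq_add_neg]
  rw [h2, h, Finset.card_univ, Fintype.card_fin, Nat.sub_sub_self hℓ, esymmVec, Finset.mul_sum]
  refine Finset.sum_congr rfl fun I hI => ?_
  rw [Finset.prod_neg, (Finset.mem_powersetCard.mp hI).2, ← mul_assoc, ← mul_pow]
  simp

theorem E_pos {m ℓ : ℕ} (hℓ : ℓ ≤ m) {M : Matrix (Fin m) (Fin m) ℝ} (hM : M.PosDef) :
    0 < E ℓ M := by
  rw [E, dif_pos hM.isHermitian, esymmVec]
  exact Finset.sum_pos (fun I _ => Finset.prod_pos fun i _ => hM.eigenvalues_pos i)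
    (Finset.powersetCard_nonempty.mpr (by simpa using hℓ))

/-- In coordinates where a positive definite matrix is diagonal up to congruence by `P`, `E ℓ` of
its inverse is a combination of the products `∏ i ∈ I, (d i)⁻¹` whose coefficients, principal minors
of `P⁻¹ * (P⁻¹)ᵀ`, do not depend on `d`. -/
theorem E_inv_congr_diagonal {m ℓ : ℕ} (hℓ : ℓ ≤ m)
    (P : Matrix (Fin m) (Fin m) ℝ) {d : Fin m → ℝ} (hd : ∀ i, 0 < d i) :
    E ℓ (P * diagonal d * Pᵀ)⁻¹ =
      ∑ I ∈ Finset.powersetCard ℓ (Finset.univ : Finset (Fin m)),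
        ((P⁻¹ * (P⁻¹)ᵀ).submatrix (Subtype.val : I → Fin m) Subtype.val).det *
          ∏ i ∈ I, (d i)⁻¹ := by
  have hdiag : (diagonal d)⁻¹ = diagonal fun i => (d i)⁻¹ := by
    refine inv_eq_right_inv ?_
    rw [diagonal_mul_diagonal, ← diagonal_one]
    congr 1
    ext i
    exact mul_inv_cancel₀ (hd i).ne'
  have hinv : (P * diagonal d * Pᵀ)⁻¹ = (P⁻¹)ᵀ * ((diagonal fun i => (d i)⁻¹) * P⁻¹) := by
    rw [Matrix.mul_inv_rev, Matrix.mul_inv_rev, hdiag, transpose_nonsing_inv]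
  have hH : (P * diagonal d * Pᵀ)⁻¹.IsHermitian := by
    rw [hinv]
    simp [IsHermitian, conjTranspose_eq_transpose_of_trivial, Matrix.mul_assoc]
  have hminors := charpoly_coeff_eq_sum_minors ((diagonal fun i => (d i)⁻¹) * (P⁻¹ * (P⁻¹)ᵀ)) ℓ
    (by simpa using hℓ)
  rw [Fintype.card_fin] at hminors
  -- The factor `(P⁻¹)ᵀ` moves to the right, as `charpoly (A * B) = charpoly (B * A)`.
  rw [E_eq_charpoly_coeff hℓ hH, hinv, charpoly_mul_comm, Matrix.mul_assoc, hminors, ← mul_assoc,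
    ← mul_pow, neg_one_mul, neg_neg, one_pow, one_mul]
  refine Finset.sum_congr rfl fun I _ => ?_
  have hsub : ((diagonal fun i => (d i)⁻¹) * (P⁻¹ * (P⁻¹)ᵀ)).submatrix
      (Subtype.val : I → Fin m) Subtype.val =
      diagonal (fun i : I => (d i)⁻¹) * (P⁻¹ * (P⁻¹)ᵀ).submatrix Subtype.val Subtype.val := by
    ext i j
    simp [diagonal_mul]
  rw [hsub, det_mul, det_diagonal, mul_comm, Finset.prod_coe_sort I fun i => (d i)⁻¹]

open scoped MatrixOrder in
/-- Two positive definite matrices are simultaneously diagonalized by a congruence. -/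
theorem exists_simultaneous_congr {m : ℕ} {A B : Matrix (Fin m) (Fin m) ℝ} (hA : A.PosDef)
    (hB : B.PosDef) : ∃ (P : Matrix (Fin m) (Fin m) ℝ) (d : Fin m → ℝ), IsUnit P ∧
      (∀ i, 0 < d i) ∧ A = P * Pᵀ ∧ B = P * diagonal d * Pᵀ := by
  obtain ⟨Y, hY⟩ := CStarAlgebra.nonneg_iff_eq_star_mul_self.mp hA.posSemidef.nonneg
  have hY' : A = Yᵀ * Y := by
    rw [hY, star_eq_conjTranspose, conjTranspose_eq_transpose_of_trivial]
  have hYu : IsUnit Y := by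
    have := hA.isUnit
    rw [isUnit_iff_isUnit_det, hY', det_mul] at this
    rw [isUnit_iff_isUnit_det]
    exact isUnit_of_mul_isUnit_right this
  have hYdet := (isUnit_iff_isUnit_det Y).mp hYu
  have hYinv : IsUnit Y⁻¹ := by simpa using hYu
  -- `C` is `B` in coordinates where `A` is the identity.
  set C := (Y⁻¹)ᵀ * B * Y⁻¹ with hC
  have hCpos : C.PosDef := by
    have := hB.conjTranspose_mul_mul_same (mulVec_injective_of_isUnit hYinv)
    rwa [conjTranspose_eq_transpose_of_trivial] at this
  set U : Matrix (Fin m) (Fin m) ℝ := ↑hCpos.isHermitian.eigenvectorUnitary with hU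
  have hUU : U * Uᵀ = 1 := by
    have := Unitary.coe_mul_star_self hCpos.isHermitian.eigenvectorUnitary
    rwa [Unitary.coe_star, star_eq_conjTranspose, conjTranspose_eq_transpose_of_trivial] at this
  obtain ⟨d, hd, hspec⟩ : ∃ d : Fin m → ℝ, (∀ i, 0 < d i) ∧ C = U * diagonal d * Uᵀ := by
    refine ⟨hCpos.isHermitian.eigenvalues, hCpos.eigenvalues_pos, ?_⟩
    have := hCpos.isHermitian.spectral_theorem
    rw [Unitary.conjStarAlgAut_apply, star_eq_conjTranspose,
      conjTranspose_eq_transpose_of_trivial] at this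
    exact this
  refine ⟨Yᵀ * U, d, ?_, hd, ?_, ?_⟩
  · exact ((isUnit_transpose Y).mpr hYu).mul (IsUnit.of_mul_eq_one _ hUU)
  · rw [transpose_mul, transpose_transpose, Matrix.mul_assoc, ← Matrix.mul_assoc U, hUU,
      Matrix.one_mul, hY']
  · have h1 : Yᵀ * C * Y = B := by
      rw [hC, ← Matrix.mul_assoc, ← Matrix.mul_assoc, ← transpose_mul, nonsing_inv_mul _ hYdet,
        transpose_one, Matrix.one_mul, Matrix.mul_assoc, nonsing_inv_mul _ hYdet, Matrix.mul_one]
    rw [← h1, hspec, transpose_mul, transpose_transpose]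
    simp only [Matrix.mul_assoc]

theorem convex_posDef (m : ℕ) : Convex ℝ {A : Matrix (Fin m) (Fin m) ℝ | A.PosDef} :=
  convex_iff_forall_pos.mpr fun _ hA _ hB _ _ ha hb _ =>
    (PosDef.smul hA ha).add (PosDef.smul hB hb)

/-- The heart of the argument: `A ↦ E ℓ A⁻¹` is log-convex on positive definite matrices. -/
theorem convexOn_log_E_inv {m ℓ : ℕ} (hℓ : ℓ ≤ m) :
    ConvexOn ℝ {A : Matrix (Fin m) (Fin m) ℝ | A.PosDef} fun A => Real.log (E ℓ A⁻¹) := by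
  refine convexOn_iff_forall_pos.mpr ⟨convex_posDef m, fun A hA B hB a b ha hb hab => ?_⟩
  obtain ⟨P, d, hP, hd, hAP, hBP⟩ := exists_simultaneous_congr hA hB
  have hcomb : a • A + b • B = P * diagonal (fun i => a + b * d i) * Pᵀ := by
    have : diagonal (fun i => a + b * d i) =
        a • (1 : Matrix (Fin m) (Fin m) ℝ) + b • diagonal d := by
      ext i j
      by_cases h : i = j <;> simp [h]
    rw [this, Matrix.mul_add, Matrix.add_mul, hAP, hBP]
    simp
  have hA1 : A = P * diagonal (fun _ => 1) * Pᵀ := by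
    rw [diagonal_one, Matrix.mul_one, hAP]
  have hab0 : ∀ i, 0 < a + b * d i := fun i => add_pos ha (mul_pos hb (hd i))
  have hQ : (P⁻¹ * (P⁻¹)ᵀ).PosDef := by
    have hPinv : IsUnit P⁻¹ := by simpa using hP
    have := PosDef.mul_conjTranspose_self P⁻¹ (vecMul_injective_of_isUnit hPinv)
    rwa [conjTranspose_eq_transpose_of_trivial] at this
  simp only [smul_eq_mul]
  rw [hcomb, hA1, hBP, E_inv_congr_diagonal hℓ P hab0, E_inv_congr_diagonal hℓ P hd,
    E_inv_congr_diagonal hℓ P fun _ => one_pos]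
  refine log_sum_mul_le _ (Finset.powersetCard_nonempty.mpr (by simpa using hℓ))
    (fun I _ => (hQ.submatrix Subtype.val_injective).det_pos)
    (fun I _ => Finset.prod_pos fun i _ => inv_pos.mpr (hab0 i)) (fun I _ => by simp)
    (fun I _ => Finset.prod_pos fun i _ => inv_pos.mpr (hd i)) ha hb hab fun I _ => ?_
  rw [inv_one, Finset.prod_const_one, Real.one_rpow, one_mul,
    ← Real.finsetProd_rpow _ _ fun i _ => (inv_pos.mpr (hd i)).le]
  refine Finset.prod_le_prod (fun i _ => (inv_pos.mpr (hab0 i)).le) fun i _ => ?_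
  rw [Real.inv_rpow (hd i).le]
  refine inv_anti₀ (Real.rpow_pos_of_pos (hd i) b) ?_
  have := Real.geom_mean_le_arith_mean2_weighted ha.le hb.le zero_le_one (hd i).le hab
  rwa [Real.one_rpow, one_mul, mul_one] at this

/-- On nonnegative weights, invertibility of the information matrix is positive definiteness. -/
theorem isUnit_information_iff_posDef {n m : ℕ} (X : Matrix (Fin n) (Fin m) ℝ) {z : Fin n → ℝ}
    (hz : ∀ i, 0 ≤ z i) :
    IsUnit (Xᵀ * diagonal z * X) ↔ (Xᵀ * diagonal z * X).PosDef := by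
  have h := (PosSemidef.diagonal (d := z) hz).conjTranspose_mul_mul_same X
  rw [conjTranspose_eq_transpose_of_trivial] at h
  exact h.posDef_iff_isUnit.symm

/-- The information matrix `Xᵀ * M * X`, as a linear map in `M`. -/
def informationMap {n m : ℕ} (X : Matrix (Fin n) (Fin m) ℝ) :
    Matrix (Fin n) (Fin n) ℝ →ₗ[ℝ] Matrix (Fin m) (Fin m) ℝ where
  toFun M := Xᵀ * M * X
  map_add' _ _ := by rw [Matrix.mul_add, Matrix.add_mul]
  map_smul' _ _ := by simp

theorem convex_relaxedFeasible {n m : ℕ} (X : Matrix (Fin n) (Fin m) ℝ) (k : ℕ) :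
    Convex ℝ (relaxedFeasible X k) := by
  have hset : relaxedFeasible X k = Set.Icc 0 1 ∩
      (((informationMap X ∘ₗ diagonalLinearMap (Fin n) ℝ ℝ) ⁻¹' {A | A.PosDef}) ∩
        {z | (∑ i, LinearMap.proj (R := ℝ) (φ := fun _ : Fin n => ℝ) i) z ≤ (k : ℝ)}) := by
    ext z
    have h01 : z ∈ Set.Icc (0 : Fin n → ℝ) 1 ↔ ∀ i, 0 ≤ z i ∧ z i ≤ 1 := by
      simp [Set.mem_Icc, Pi.le_def, forall_and]
    have hsum : (∑ i, LinearMap.proj (R := ℝ) (φ := fun _ : Fin n => ℝ) i) z = ∑ i, z i := by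
      simp
    simp only [Set.mem_inter_iff, h01, Set.mem_ofPred_eq, hsum]
    exact and_congr_right fun hz =>
      and_congr_left fun _ => isUnit_information_iff_posDef X fun i => (hz i).1
  rw [hset]
  exact (convex_Icc 0 1).inter (((convex_posDef m).linear_preimage _).inter
    (convex_halfSpace_le (LinearMap.isLinear _) _))

end ESPDesign

/-- Let `X` be a real `n × m` matrix of full column rank and `1 ≤ ℓ ≤ m`. Then
`M ↦ E_ℓ((Xᵀ M X)⁻¹)^(1/ℓ)` is log-convex on the positive definite `n × n` matrices, and for every
budget `k` the continuous relaxation of ESP-design is a convex optimization problem (whose objective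
is the logarithm of a positive quantity at all feasible points). -/
theorem corollary1 (n m ℓ : ℕ) (X : Matrix (Fin n) (Fin m) ℝ) (hX : X.rank = m)
    (hℓ1 : 1 ≤ ℓ) (hℓm : ℓ ≤ m) :
    ESPDesign.LogConvexOn {M : Matrix (Fin n) (Fin n) ℝ | M.PosDef}
      (fun M => (ESPDesign.E ℓ (Xᵀ * M * X)⁻¹) ^ (1 / (ℓ : ℝ))) ∧
    ∀ k : ℕ,
      (∀ z ∈ ESPDesign.relaxedFeasible X k,
        0 < ESPDesign.E ℓ (Xᵀ * Matrix.diagonal z * X)⁻¹) ∧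
      ESPDesign.IsConvexProblem (ESPDesign.relaxedFeasible X k)
        (ESPDesign.relaxedObjective X ℓ) := by
  have hinj : Function.Injective X.mulVec := by
    rw [Matrix.mulVec_injective_iff, linearIndependent_iff_card_eq_finrank_span, Set.finrank,
      ← X.rank_eq_finrank_span_cols, hX, Fintype.card_fin]
  have hpos : ∀ M : Matrix (Fin n) (Fin n) ℝ, M.PosDef → (Xᵀ * M * X).PosDef := fun M hM => by
    have := hM.conjTranspose_mul_mul_same hinj
    rwa [Matrix.conjTranspose_eq_transpose_of_trivial] at this
  have hℓ0 : 0 ≤ 1 / (ℓ : ℝ) := by positivity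
  have hconv := ESPDesign.convexOn_log_E_inv hℓm
  refine ⟨⟨fun M hM => Real.rpow_pos_of_pos (ESPDesign.E_pos hℓm (hpos M hM).inv) _, ?_⟩,
    fun k => ⟨fun z hz => ESPDesign.E_pos hℓm
      ((ESPDesign.isUnit_information_iff_posDef X fun i => (hz.1 i).1).mp hz.2.1).inv,
      ESPDesign.convex_relaxedFeasible X k, ?_⟩⟩
  · refine (((hconv.comp_linearMap (ESPDesign.informationMap X)).subset hpos
      (ESPDesign.convex_posDef n)).smul hℓ0).congr fun M hM => ?_
    exact (Real.log_rpow (ESPDesign.E_pos hℓm (hpos M hM).inv) _).symm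
  · exact ((hconv.comp_linearMap
      (ESPDesign.informationMap X ∘ₗ Matrix.diagonalLinearMap (Fin n) ℝ ℝ)).subset
      (fun z hz => (ESPDesign.isUnit_information_iff_posDef X fun i => (hz.1 i).1).mp hz.2.1)
      (ESPDesign.convex_relaxedFeasible X k)).smul hℓ0
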